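/- All graphs are finite and simple, and $d$ denotes the graph distance. For a graph $G$, an exact $r$-coloring is a surjection $c:V(G)\to\{1,\dots,r\}$; a $3$-term arithmetic progression ($3$-AP) in $G$ is a list $(v_1,v_2,v_3)$ of vertices with $d(v_1,v_2)=d(v_2,v_3)$, and it is rainbow if its three vertices receive pairwise distinct colors. The anti-van der Waerden number $\mathrm{aw}(G,3)$ is the least positive integer $r$ such that every exact $r$-coloring of $G$ contains a rainbow $3$-AP. A vertex is peripheral if its eccentricity equals $\mathrm{diam}(G)$; $G$ is $3$-peripheral if it has three distinct vertices at pairwise distance $\mathrm{diam}(G)$, and non-$3$-peripheral otherwise. For a tree $T$ and a peripheral vertex $v$, let $T_{v^-}$ be the tree obtained from $T$ by removing all vertices at distance $\mathrm{diam}(T)$ from $v$; for any vertex $v$, let $T_{v^+}$ be the tree obtained from $T$ by adding a new leaf adjacent to $v$. Let $T$ be a nontrivial (at least two vertices) non-$3$-peripheral tree. If $\mathrm{diam}(T)$ is odd, $T$ is strongly non-$3$-peripheral if $T_{v^-}$ is non-$3$-peripheral for some peripheral vertex $v$, and weakly non-$3$-peripheral otherwise. If $\mathrm{diam}(T)$ is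 even, $T$ is strongly non-$3$-peripheral if $T_{v^+}$ is non-$3$-peripheral for every vertex $v$, and weakly non-$3$-peripheral otherwise. **Theorem.** Let $T$ and $T'$ be nontrivial trees such that the diameter of the Cartesian product $T\square T'$ is even. Then \[ \mathrm{aw}(T\square T',3)=\begin{cases}3 & \text{if $T$ or $T'$ is weakly non-$3$-peripheral or isomorphic to $P_2$,}\\ 4 & \text{if $T$ and $T'$ are both strongly non-$3$-peripheral and neither is isomorphic to $P_2$,}\end{cases} \] where $P_2$ is the path on two vertices. -/

import Mathlib

namespace AntiVdW

/-- The list `v 0, …, v (k - 1)` of vertices is a `k`-term arithmetic progression of `G`: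
consecutive vertices are all at the same (finite) distance `d`, the common difference. -/
def IsAP {V : Type*} (G : SimpleGraph V) {k : ℕ} (v : Fin k → V) : Prop :=
  ∃ d : ℕ, ∀ i j : Fin k, (j : ℕ) = (i : ℕ) + 1 → G.edist (v i) (v j) = (d : ℕ∞)

/-- The coloring `c` of the vertices of `G` has a rainbow `k`-term arithmetic progression. -/
def HasRainbowAP {V C : Type*} (G : SimpleGraph V) (k : ℕ) (c : V → C) : Prop :=
  ∃ v : Fin k → V, IsAP G v ∧ Function.Injective (fun i => c (v i))

/-- The anti-van der Waerden number `aw(G, k)`: the least positive number `r` of colors such that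
every exact `r`-coloring (a surjection onto a set of `r` colors) of the vertices of `G` has a
rainbow `k`-term arithmetic progression. For a finite graph such an `r` exists, since there is no
exact `r`-coloring with `r` greater than the number of vertices. -/
noncomputable def aw {V : Type*} (G : SimpleGraph V) (k : ℕ) : ℕ :=
  sInf {r : ℕ | 1 ≤ r ∧ ∀ c : V → Fin r, Function.Surjective c → HasRainbowAP G k c}

/-- A vertex is peripheral if its eccentricity is the diameter of the graph. -/
def IsPeripheralVertex {V : Type*} (G : SimpleGraph V) (v : V) : Prop :=
  G.eccent v = G.ediam

/-- `G` is `n`-peripheral: it has `n` distinct vertices at pairwise distance `diam G`. -/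
def IsPeripheral {V : Type*} (G : SimpleGraph V) (n : ℕ) : Prop :=
  ∃ u : Fin n → V, Function.Injective u ∧ ∀ i j : Fin n, i ≠ j → G.dist (u i) (u j) = G.diam

/-- `T_{v⁻}`: remove from `T` all vertices which realize the diameter of `T` with `v`. -/
def removeFar {V : Type*} (T : SimpleGraph V) (v : V) :
    SimpleGraph {w : V | T.dist v w ≠ T.diam} :=
  T.induce {w : V | T.dist v w ≠ T.diam}

/-- `T_{u⁺}`: the graph `T` with an additional leaf (the vertex `none`) adjacent to `u`. -/
def addLeaf {V : Type*} (T : SimpleGraph V) (u : V) : SimpleGraph (Option V) where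
  Adj
    | some a, some b => T.Adj a b
    | some a, none => a = u
    | none, some b => b = u
    | none, none => False
  symm := ⟨fun a b h => by
    cases a <;> cases b <;> first | exact h | exact T.adj_symm h⟩
  loopless := ⟨fun a h => by
    cases a
    · exact h
    · exact T.irrefl h⟩

/-- Strongly non-`3`-peripheral (used for nontrivial finite trees): non-`3`-peripheral, and
* if the diameter is odd, `T_{v⁻}` is non-`3`-peripheral for some peripheral vertex `v`;
* if the diameter is even, `T_{v⁺}` is non-`3`-peripheral for all vertices `v`. -/
def IsStronglyNonThreePeripheral {V : Type*} (T : SimpleGraph V) : Prop :=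
  ¬ IsPeripheral T 3 ∧
    (Odd T.diam → ∃ v : V, IsPeripheralVertex T v ∧ ¬ IsPeripheral (removeFar T v) 3) ∧
    (Even T.diam → ∀ v : V, ¬ IsPeripheral (addLeaf T v) 3)

/-- Weakly non-`3`-peripheral (used for nontrivial finite trees): non-`3`-peripheral, and
* if the diameter is odd, `T_{v⁻}` is `3`-peripheral for all peripheral vertices `v`;
* if the diameter is even, `T_{v⁺}` is `3`-peripheral for some vertex `v`. -/
def IsWeaklyNonThreePeripheral {V : Type*} (T : SimpleGraph V) : Prop :=
  ¬ IsPeripheral T 3 ∧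
    (Odd T.diam → ∀ v : V, IsPeripheralVertex T v → IsPeripheral (removeFar T v) 3) ∧
    (Even T.diam → ∃ v : V, IsPeripheral (addLeaf T v) 3)

/-- `T` is isomorphic to the path `P₂` on two vertices. -/
def IsP2 {V : Type*} (T : SimpleGraph V) : Prop :=
  Nonempty (T ≃g SimpleGraph.pathGraph 2)

end AntiVdW

/-!
Trees have medians and satisfy the four-point condition. So `T □ T'` has medians, and the three
distances between any three of its vertices have an even sum. In a coloring of `T □ T'` with at
least three colors and no rainbow `3`-AP, a shortest walk meeting three colors is as long as a
geodesic of odd length `ℓ` from `x` to `z` whose inner vertices all have one color, and every vertex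
at distance `ℓ` from an end of such a geodesic is again the end of one, with the same color. Moving
the ends stretches it to a diametral pair in either factor. Then no room is left for a fourth color.
Moreover, if the diameter of `T □ T'` is even, the geodesic is not itself diametral, and the
remaining room shows that the diametral pair `u`, `u'` of `T` (and likewise of `T'`) is unobstructed
up to order: no vertex at distance `diam T - 1` from `u` has distance at least `diam T - 1` from
`u'`.

Conversely, if the pairs `u`, `u'` of `T` and `v`, `v'` of `T'` are unobstructed, color a vertex of
`T □ T'` by `0` if its distance from `(u', v')` is the diameter, by `1` if its distance from
`(u, v)` is one less than the diameter, and by `2` otherwise. Vertices of color `0` have the same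
large distances as `(u, v)`, so a progression with the color `0` or `1` in the middle and the other
one at an end does not contain the color `2`; evenness of the diameter excludes the colors `0` and
`1` at the two ends.

For trees other than `P₂`, the existence of an unobstructed pair distinguishes the strongly from the
weakly non-`3`-peripheral ones: for odd diameter, an obstruction of `u`, `u'` forms with `u` and a
neighbour of `u'` a triple at pairwise distance `diam T - 1` in `T_{u⁻}`; for even diameter, a
vertex `p` is an obstruction if `u`, `u'` and the new leaf of `T_{p⁺}` have pairwise distance
`diam T`.
-/

namespace AntiVdW

open SimpleGraph

section Distance

variable {V W : Type*} {G : SimpleGraph V} {H : SimpleGraph W}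

theorem exists_dist_eq_of_le (hG : G.Connected) {x y : V} {s : ℕ} (hs : s ≤ G.dist x y) :
    ∃ t, G.dist x t = s ∧ s + G.dist t y = G.dist x y := by
  obtain ⟨p, hp⟩ := hG.exists_walk_length_eq_dist x y
  have h₁ := dist_le (p.take s)
  have h₂ := dist_le (p.drop s)
  have h₃ := hG.dist_triangle (u := x) (v := p.getVert s) (w := y)
  rw [Walk.take_length] at h₁
  rw [Walk.drop_length] at h₂
  exact ⟨p.getVert s, by omega, by omega⟩

theorem le_add_dist (hG : G.Connected) {f : V → ℕ}
    (hf : ∀ x y, G.Adj x y → f y ≤ f x + 1) (x y : V) : f y ≤ f x + G.dist x y := by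
  obtain ⟨p, hp⟩ := hG.exists_walk_length_eq_dist x y
  rw [← hp]
  clear hp
  induction p with
  | nil => exact le_rfl
  | cons h p ih =>
    rw [Walk.length_cons]
    have := hf _ _ h
    omega

theorem ediam_ne_top_of_forall_dist_le (hG : G.Connected) {k : ℕ}
    (h : ∀ x y, G.dist x y ≤ k) : G.ediam ≠ ⊤ := by
  refine ne_top_of_le_ne_top (ENat.natCast_ne_top k) (ediam_le_of_edist_le fun x y => ?_)
  rw [← (hG x y).coe_dist_eq_edist]
  exact_mod_cast h x y

theorem diam_eq_of_forall_dist_le (hG : G.Connected) {x y : V} {k : ℕ}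
    (hxy : G.dist x y = k) (h : ∀ x y, G.dist x y ≤ k) : G.diam = k := by
  have := hG.nonempty
  obtain ⟨a, b, hab⟩ := G.exists_dist_eq_diam
  exact le_antisymm (hab ▸ h a b) (hxy ▸ dist_le_diam (ediam_ne_top_of_forall_dist_le hG h))

theorem edist_map_le (f : G →g H) (x y : V) : H.edist (f x) (f y) ≤ G.edist x y :=
  le_iInf fun p => (edist_le (p.map f)).trans_eq (by rw [Walk.length_map])

theorem edist_iso (e : G ≃g H) (x y : V) : H.edist (e x) (e y) = G.edist x y :=
  le_antisymm (edist_map_le e.toHom x y) (by simpa using edist_map_le e.symm.toHom (e x) (e y))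

theorem dist_iso (e : G ≃g H) (x y : V) : H.dist (e x) (e y) = G.dist x y :=
  congrArg ENat.toNat (edist_iso e x y)

theorem dist_boxProd (hG : G.Connected) (hH : H.Connected) (x y : V × W) :
    (G □ H).dist x y = G.dist x.1 y.1 + H.dist x.2 y.2 := by
  have h := edist_boxProd (G := G) (H := H) x y
  rw [← (hG x.1 y.1).coe_dist_eq_edist, ← (hH x.2 y.2).coe_dist_eq_edist,
    ← ((hG.boxProd hH) x y).coe_dist_eq_edist] at h
  exact_mod_cast h

theorem diam_boxProd (hG : G.Connected) (hH : H.Connected) (hGd : G.ediam ≠ ⊤)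
    (hHd : H.ediam ≠ ⊤) : (G □ H).diam = G.diam + H.diam := by
  have := hG.nonempty
  have := hH.nonempty
  obtain ⟨a, b, hab⟩ := G.exists_dist_eq_diam
  obtain ⟨a', b', hab'⟩ := H.exists_dist_eq_diam
  refine diam_eq_of_forall_dist_le (hG.boxProd hH) (x := (a, a')) (y := (b, b')) ?_ fun x y => ?_
  · rw [dist_boxProd hG hH, hab, hab']
  · rw [dist_boxProd hG hH]
    exact Nat.add_le_add (dist_le_diam hGd) (dist_le_diam hHd)

end Distance

section Medians

variable {V W : Type*} {G : SimpleGraph V} {H : SimpleGraph W}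

/-- Any three vertices of the connected graph `G` have a median, a vertex lying on a geodesic
between each two of them. It need not be unique, so that every median graph qualifies. -/
structure HasMedians (G : SimpleGraph V) : Prop where
  connected : G.Connected
  exists_median : ∀ x y z, ∃ t, G.dist x t + G.dist t y = G.dist x y ∧
    G.dist x t + G.dist t z = G.dist x z ∧ G.dist y t + G.dist t z = G.dist y z

namespace HasMedians

theorem even_dist_add (hG : HasMedians G) (x y z : V) :
    Even (G.dist x y + G.dist x z + G.dist y z) := by
  obtain ⟨t, h₁, h₂, h₃⟩ := hG.exists_median x y z
  rw [G.dist_comm (u := y)] at h₃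
  exact ⟨G.dist x t + G.dist t y + G.dist t z, by omega⟩

theorem boxProd (hG : HasMedians G) (hH : HasMedians H) : HasMedians (G □ H) where
  connected := hG.connected.boxProd hH.connected
  exists_median x y z := by
    obtain ⟨s, h₁, h₂, h₃⟩ := hG.exists_median x.1 y.1 z.1
    obtain ⟨t, k₁, k₂, k₃⟩ := hH.exists_median x.2 y.2 z.2
    simp only [dist_boxProd hG.connected hH.connected]
    refine ⟨(s, t), ?_, ?_, ?_⟩ <;> dsimp only <;> omega

end HasMedians

end Medians

section Trees

variable {V : Type*} {T : SimpleGraph V}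

theorem length_eq_dist_of_isPath (hT : T.IsTree) {x y : V} {p : T.Walk x y} (hp : p.IsPath) :
    p.length = T.dist x y := by
  obtain ⟨q, hq, hql⟩ := hT.connected.exists_path_of_dist x y
  have hpq : p = q :=
    congrArg Subtype.val ((hT.isAcyclic.subsingleton_path x y).elim ⟨p, hp⟩ ⟨q, hq⟩)
  rw [hpq, hql]

theorem isPath_append {x y z : V} {p : T.Walk x y} {q : T.Walk y z} (hp : p.IsPath)
    (hq : q.IsPath) (h : ∀ v ∈ p.support, v ∈ q.support → v = y) : (p.append q).IsPath := by
  have hy : y ∉ q.support.tail := by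
    have hnodup := hq.support_nodup
    rw [← Walk.cons_tail_support] at hnodup
    exact (List.nodup_cons.1 hnodup).1
  rw [Walk.isPath_def, Walk.support_append, List.nodup_append']
  exact ⟨hp.support_nodup, hq.support_nodup.tail, fun v hvp hvq =>
    hy (h v hvp (List.mem_of_mem_tail hvq) ▸ hvq)⟩

theorem exists_projection_mem_support (hT : T.IsTree) {x y : V} {p : T.Walk x y}
    (hp : p.IsPath) (z : V) :
    ∃ v ∈ p.support, T.dist x v + T.dist v z = T.dist x z ∧
      T.dist y v + T.dist v z = T.dist y z := by
  classical
  obtain ⟨v, hv, hmin⟩ := p.support.toFinset.exists_min_image (T.dist · z) ⟨x, by simp⟩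
  simp only [List.mem_toFinset] at hv hmin
  obtain ⟨q, hq, hql⟩ := hT.connected.exists_path_of_dist v z
  have eq_of_mem : ∀ w ∈ p.support, w ∈ q.support → w = v := by
    intro w hwp hwq
    have h₁ := hmin w hwp
    have h₂ := length_eq_dist_of_isPath hT (hq.takeUntil hwq)
    have h₃ := length_eq_dist_of_isPath hT (hq.dropUntil hwq)
    have h₄ := congrArg Walk.length (q.take_spec hwq)
    rw [Walk.length_append] at h₄
    exact (hT.connected.dist_eq_zero_iff.1 (by omega)).symm
  have dist_add : ∀ {u} {r : T.Walk u v}, r.IsPath → r.support ⊆ p.support →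
      T.dist u v + T.dist v z = T.dist u z := by
    intro u r hr hrp
    rw [← length_eq_dist_of_isPath hT hr, ← hql, ← Walk.length_append]
    exact length_eq_dist_of_isPath hT
      (isPath_append hr hq fun w hw hwq => eq_of_mem w (hrp hw) hwq)
  refine ⟨v, hv, dist_add (hp.takeUntil hv) (p.support_takeUntil_subset_support hv),
    dist_add (hp.dropUntil hv).reverse ?_⟩
  rw [Walk.support_reverse]
  exact fun w hw => p.support_dropUntil_subset_support hv (List.mem_reverse.1 hw)

theorem dist_add_of_mem_support (hT : T.IsTree) {x y v : V} {p : T.Walk x y} (hp : p.IsPath)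
    (hv : v ∈ p.support) : T.dist x v + T.dist v y = T.dist x y := by
  classical
  rw [← length_eq_dist_of_isPath hT (hp.takeUntil hv),
    ← length_eq_dist_of_isPath hT (hp.dropUntil hv), ← length_eq_dist_of_isPath hT hp,
    ← Walk.length_append, p.take_spec hv]

theorem HasMedians.of_isTree (hT : T.IsTree) : HasMedians T where
  connected := hT.connected
  exists_median x y z := by
    obtain ⟨p, hp, -⟩ := hT.connected.exists_path_of_dist x y
    obtain ⟨t, ht, h₁, h₂⟩ := exists_projection_mem_support hT hp z
    exact ⟨t, dist_add_of_mem_support hT hp ht, h₁, h₂⟩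

theorem dist_add_dist_le_or (hT : T.IsTree) (x y z w : V) :
    T.dist x y + T.dist z w ≤ T.dist x z + T.dist y w ∨
      T.dist x y + T.dist z w ≤ T.dist x w + T.dist y z := by
  classical
  obtain ⟨p, hp, -⟩ := hT.connected.exists_path_of_dist x y
  obtain ⟨s, hs, hxs, hys⟩ := exists_projection_mem_support hT hp z
  obtain ⟨t, ht, hxt, hyt⟩ := exists_projection_mem_support hT hp w
  have hs' := dist_add_of_mem_support hT hp hs
  have ht' := dist_add_of_mem_support hT hp ht
  have hzsw := hT.connected.dist_triangle (u := z) (v := s) (w := w)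
  have hstw := hT.connected.dist_triangle (u := s) (v := t) (w := w)
  have hst : t ∈ (p.takeUntil s hs).support ∨ t ∈ (p.dropUntil s hs).support := by
    rwa [← Walk.mem_support_append_iff, p.take_spec hs]
  rcases hst with hst | hst
  · have hxts := dist_add_of_mem_support hT (hp.takeUntil hs) hst
    simp only [T.dist_comm] at *
    omega
  · have hsty := dist_add_of_mem_support hT (hp.dropUntil hs) hst
    simp only [T.dist_comm] at *
    omega

theorem exists_dist_eq_succ (hT : T.IsTree) {u v : V} (huv : T.dist u v < T.diam) :
    (∃ w, T.dist u w = T.dist u v + 1) ∨ ∃ w, T.dist v w = T.dist u v + 1 := by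
  have := hT.connected.nonempty
  obtain ⟨a, b, hab⟩ := T.exists_dist_eq_diam
  have exists_of_lt : ∀ x y, T.dist u v < T.dist x y → ∃ w, T.dist x w = T.dist u v + 1 :=
    fun x y h => (exists_dist_eq_of_le hT.connected h).imp fun _ hw => hw.1
  have hlt : T.dist u v < T.dist u a ∨ T.dist u v < T.dist u b ∨
      T.dist u v < T.dist v a ∨ T.dist u v < T.dist v b := by
    have := dist_add_dist_le_or hT u v a b
    omega
  rcases hlt with h | h | h | h
  exacts [.inl (exists_of_lt _ _ h), .inl (exists_of_lt _ _ h), .inr (exists_of_lt _ _ h),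
    .inr (exists_of_lt _ _ h)]

end Trees

section Rainbow

variable {V C : Type*} {G : SimpleGraph V} {c : V → C} {x y z : V}

/-- The vertices `x`, `y`, `z` have three distinct colors. -/
def IsRainbow (c : V → C) (x y z : V) : Prop :=
  c x ≠ c y ∧ c y ≠ c z ∧ c x ≠ c z

/-- `c` has no rainbow `3`-term arithmetic progression, in terms of the graph distance. For a
disconnected graph, whose distance has junk values, this differs from `¬ HasRainbowAP G 3 c`. -/
def IsRainbowAPFree (G : SimpleGraph V) (c : V → C) : Prop :=
  ∀ x y z, G.dist x y = G.dist y z → ¬ IsRainbow c x y z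

theorem not_hasRainbowAP_three_iff (hG : G.Connected) :
    ¬ HasRainbowAP G 3 c ↔ IsRainbowAPFree G c := by
  have edist_eq : ∀ x y, G.edist x y = (G.dist x y : ℕ∞) := fun x y =>
    (hG x y).coe_dist_eq_edist.symm
  rw [not_iff_comm]
  simp only [IsRainbowAPFree, not_forall, not_not, HasRainbowAP, IsAP, IsRainbow, edist_eq,
    Nat.cast_inj]
  constructor
  · rintro ⟨x, y, z, hxyz, hxy, hyz, hxz⟩
    refine ⟨![x, y, z], ⟨G.dist x y, fun i j hij => ?_⟩, fun i j hij => ?_⟩ <;>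
      fin_cases i <;> fin_cases j <;> simp_all
  · rintro ⟨v, ⟨k, hk⟩, hv⟩
    exact ⟨v 0, v 1, v 2, (hk 0 1 rfl).trans (hk 1 2 rfl).symm, hv.ne (by decide),
      hv.ne (by decide), hv.ne (by decide)⟩

theorem three_le_of_forall_hasRainbowAP [Nontrivial V] {r : ℕ} (hr : 1 ≤ r)
    (h : ∀ c : V → Fin r, c.Surjective → HasRainbowAP G 3 c) : 3 ≤ r := by
  classical
  by_contra hr3
  obtain ⟨x, y, hxy⟩ := exists_pair_ne V
  obtain ⟨c, hc⟩ : ∃ c : V → Fin r, c.Surjective := by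
    obtain rfl | rfl : r = 1 ∨ r = 2 := by omega
    · exact ⟨fun _ => 0, fun i => ⟨x, Subsingleton.elim _ _⟩⟩
    · exact ⟨fun z => if z = x then 0 else 1, Fin.forall_fin_two.2 ⟨⟨x, if_pos rfl⟩,
        ⟨y, if_neg hxy.symm⟩⟩⟩
  obtain ⟨v, -, hv⟩ := h c hc
  exact hr3 (by simpa using Fintype.card_le_of_injective _ hv)

theorem aw_eq_three [Nontrivial V]
    (h : ∀ c : V → Fin 3, c.Surjective → HasRainbowAP G 3 c) : aw G 3 = 3 :=
  le_antisymm (Nat.sInf_le ⟨by norm_num, h⟩)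
    (le_csInf ⟨3, by norm_num, h⟩ fun _ hr => three_le_of_forall_hasRainbowAP hr.1 hr.2)

theorem aw_eq_four [Nontrivial V]
    (h : ∀ c : V → Fin 4, c.Surjective → HasRainbowAP G 3 c)
    {c : V → Fin 3} (hc : c.Surjective) (hcG : ¬ HasRainbowAP G 3 c) : aw G 3 = 4 := by
  refine le_antisymm (Nat.sInf_le ⟨by norm_num, h⟩) (le_csInf ⟨4, by norm_num, h⟩ fun r hr => ?_)
  refine (three_le_of_forall_hasRainbowAP hr.1 hr.2).lt_of_ne ?_
  rintro rfl
  exact hcG (hr.2 c hc)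

end Rainbow

section RainbowLength

variable {V W C : Type*} {G : SimpleGraph V} {H : SimpleGraph W} {c : V → C}
  {α β γ : C} {x y z w t p : V}

/-- The least length of a walk `x, …, y, …, z` through a rainbow triple; it is `0` if there is no
such triple. -/
noncomputable def rainbowLength (G : SimpleGraph V) (c : V → C) : ℕ :=
  sInf {k | ∃ x y z, IsRainbow c x y z ∧ G.dist x y + G.dist y z = k}

theorem rainbowLength_le (h : IsRainbow c x y z) :
    rainbowLength G c ≤ G.dist x y + G.dist y z :=
  Nat.sInf_le ⟨x, y, z, h, rfl⟩

theorem exists_isRainbow_dist_add_eq (h : ∃ x y z, IsRainbow c x y z) :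
    ∃ x y z, IsRainbow c x y z ∧ G.dist x y + G.dist y z = rainbowLength G c := by
  obtain ⟨x, y, z, h⟩ := h
  exact Nat.sInf_mem (s := {k | ∃ x y z, IsRainbow c x y z ∧ G.dist x y + G.dist y z = k})
    ⟨_, x, y, z, h, rfl⟩

theorem IsRainbow.ne_left (h : IsRainbow c x y z) : x ≠ y := ne_of_apply_ne c h.1

theorem IsRainbow.ne_right (h : IsRainbow c x y z) : y ≠ z := ne_of_apply_ne c h.2.1

/-- A shortest walk through three colors which is a geodesic from `x` to `z` with first step `w`,
where the middle color occurs. -/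
structure IsRainbowGeodesic (G : SimpleGraph V) (c : V → C) (x w z : V) : Prop where
  isRainbow : IsRainbow c x w z
  dist_step : G.dist x w = 1
  dist_step_add_one : G.dist w z + 1 = rainbowLength G c
  dist_eq : G.dist x z = rainbowLength G c

theorem exists_isRainbowGeodesic (hG : HasMedians G) (h : ∃ x y z, IsRainbow c x y z) :
    ∃ x w z, IsRainbowGeodesic G c x w z := by
  obtain ⟨x, y, z, h, hm⟩ := exists_isRainbow_dist_add_eq (G := G) h
  have hxy := hG.connected.pos_dist_of_ne h.ne_left
  have hyz := hG.connected.pos_dist_of_ne h.ne_right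
  obtain ⟨w, hxw, hwy⟩ := exists_dist_eq_of_le hG.connected hxy
  have hwx : c x ≠ c w := fun e => by
    have := rainbowLength_le (G := G) (show IsRainbow c w y z by rwa [IsRainbow, ← e])
    omega
  have hcw : c w = c y := by
    by_contra e
    have := rainbowLength_le (G := G) ⟨hwx, e, h.1⟩
    omega
  have hw : IsRainbow c x w z := by rwa [IsRainbow, hcw]
  have h₁ := rainbowLength_le (G := G) hw
  have h₂ := rainbowLength_le (G := G) ⟨hw.1.symm, hw.2.2, hw.2.1⟩
  have h₃ := hG.connected.dist_triangle (u := w) (v := y) (w := z)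
  have h₄ := hG.connected.dist_triangle (u := x) (v := w) (w := z)
  have h₅ := G.dist_comm (u := w) (v := x)
  obtain ⟨k, hk⟩ := hG.even_dist_add x w z
  exact ⟨x, w, z, hw, hxw, by omega, by omega⟩

namespace IsRainbowGeodesic

theorem color_eq_of_step (h : IsRainbowGeodesic G c x w z)
    (ht : G.dist w t + G.dist t z = G.dist w z) (htz : G.dist t z ≠ 0) : c t = c w := by
  have := h.dist_step
  have := h.dist_step_add_one
  by_contra hcw
  have hcx : c x = c t := by
    by_contra hcx
    have := rainbowLength_le (G := G) ⟨h.isRainbow.1, Ne.symm hcw, hcx⟩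
    omega
  have := rainbowLength_le (G := G) ⟨Ne.symm hcw, hcx ▸ h.isRainbow.2.2, h.isRainbow.2.1⟩
  omega

theorem odd_rainbowLength (hG : G.Connected) (hc : IsRainbowAPFree G c)
    (h : IsRainbowGeodesic G c x w z) : Odd (rainbowLength G c) := by
  have hxw := h.dist_step
  have hwz := h.dist_step_add_one
  have hxz := h.dist_eq
  have hpos := hG.pos_dist_of_ne h.isRainbow.ne_right
  by_contra hodd
  obtain ⟨k, hk⟩ := Nat.not_odd_iff_even.1 hodd
  obtain ⟨t, hwt, htz⟩ := exists_dist_eq_of_le hG (x := w) (y := z) (s := k - 1) (by omega)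
  have hct := h.color_eq_of_step (t := t) (by omega) (by omega)
  have h₁ := hG.dist_triangle (u := x) (v := w) (w := t)
  have h₂ := hG.dist_triangle (u := x) (v := t) (w := z)
  exact hc x t z (by omega) (by simpa only [IsRainbow, hct] using h.isRainbow)

theorem color_eq_of_two_le_dist (hG : HasMedians G) (h : IsRainbowGeodesic G c x w z)
    (ht : G.dist x t + G.dist t z = G.dist x z) (hxt : t ≠ x) (htz : 2 ≤ G.dist t z) :
    c t = c w := by
  have hxw := h.dist_step
  have hwz := h.dist_step_add_one
  have hxz := h.dist_eq
  have hpos := hG.connected.pos_dist_of_ne hxt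
  obtain ⟨s, hts, hs, hws⟩ := hG.exists_median t w z
  have e₁ := hG.connected.dist_triangle (u := w) (v := x) (w := t)
  have e₂ := hG.connected.dist_triangle (u := w) (v := t) (w := z)
  have hxwt := hG.even_dist_add t w z
  simp only [G.dist_comm (u := t) (v := x), G.dist_comm (u := w) (v := x),
    G.dist_comm (u := s) (v := w), G.dist_comm (u := w) (v := t)] at *
  obtain ⟨l, hl⟩ := hxwt
  by_cases hts₀ : G.dist t s = 0
  · obtain rfl := hG.connected.dist_eq_zero_iff.1 hts₀
    exact h.color_eq_of_step (by omega) (by omega)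
  have hcs : c s = c w := h.color_eq_of_step hws (by omega)
  by_contra hct
  rw [← hcs] at hct
  have hrainbow : IsRainbow c x s z := by simpa only [IsRainbow, hcs] using h.isRainbow
  have hcx : c x = c t := by
    by_contra hcx
    have := rainbowLength_le (G := G) ⟨hcx, hct, hrainbow.1⟩
    omega
  have := rainbowLength_le (G := G) ⟨hct, hrainbow.2.1, hcx ▸ hrainbow.2.2⟩
  omega

theorem color_eq_of_between (hG : HasMedians G) (hc : IsRainbowAPFree G c)
    (h : IsRainbowGeodesic G c x w z) (ht : G.dist x t + G.dist t z = G.dist x z) (hxt : t ≠ x)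
    (htz : t ≠ z) : c t = c w := by
  by_cases htz₂ : 2 ≤ G.dist t z
  · exact h.color_eq_of_two_le_dist hG ht hxt htz₂
  have htz₁ := hG.connected.pos_dist_of_ne htz
  have hwz₁ := hG.connected.pos_dist_of_ne h.isRainbow.ne_right
  have hwz := h.dist_step_add_one
  have hxz := h.dist_eq
  obtain ⟨k, hk⟩ := h.odd_rainbowLength hG.connected hc
  have color_eq_of_between_left : ∀ s, G.dist x s + G.dist s t = G.dist x t → G.dist x s ≠ 0 →
      G.dist s t ≠ 0 → c s = c w := fun s hs hxs hst => by
    have h₁ := hG.connected.dist_triangle (u := s) (v := t) (w := z)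
    have h₂ := hG.connected.dist_triangle (u := x) (v := s) (w := z)
    exact h.color_eq_of_two_le_dist hG (by omega) (by rintro rfl; simp at hxs) (by omega)
  obtain ⟨s, hxs, hst⟩ := exists_dist_eq_of_le hG.connected (x := x) (y := t) (s := k) (by omega)
  obtain ⟨r, hxr, hrt⟩ :=
    exists_dist_eq_of_le hG.connected (x := x) (y := t) (s := 2 * k - 1) (by omega)
  have hcs := color_eq_of_between_left s (by omega) (by omega) (by omega)
  have hcr := color_eq_of_between_left r (by omega) (by omega) (by omega)
  by_contra hct
  have hcx : c x = c t := by
    by_contra hcx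
    exact hc x s t (by omega) ⟨hcs ▸ h.isRainbow.1, hcs ▸ Ne.symm hct, hcx⟩
  have := rainbowLength_le (G := G)
    (show IsRainbow c r t z from ⟨hcr ▸ Ne.symm hct, hcx ▸ h.isRainbow.2.2, hcr ▸ h.isRainbow.2.1⟩)
  omega

end IsRainbowGeodesic

/-- The coloring `c` has no rainbow progression, the colors `α`, `β`, `γ` are distinct, `x` and `z`
have the colors `α` and `γ` and distance `rainbowLength G c`, and all other vertices of geodesics
between them have the color `β`. -/
structure IsExtremalPair (G : SimpleGraph V) (c : V → C) (α β γ : C) (x z : V) : Prop where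
  isRainbowAPFree : IsRainbowAPFree G c
  ne_left : α ≠ β
  ne_right : β ≠ γ
  ne : α ≠ γ
  color_left : c x = α
  color_right : c z = γ
  dist_eq : G.dist x z = rainbowLength G c
  color_of_between : ∀ t, G.dist x t + G.dist t z = G.dist x z → t ≠ x → t ≠ z → c t = β

theorem exists_isExtremalPair (hG : HasMedians G) (hc : IsRainbowAPFree G c)
    (h : ∃ x y z, IsRainbow c x y z) : ∃ α β γ x z, IsExtremalPair G c α β γ x z :=
  let ⟨x, w, z, h⟩ := exists_isRainbowGeodesic hG h
  ⟨c x, c w, c z, x, z, hc, h.isRainbow.1, h.isRainbow.2.1, h.isRainbow.2.2, rfl, rfl, h.dist_eq,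
    fun _ => h.color_eq_of_between hG hc⟩

theorem rainbowLength_comp_iso (e : G ≃g H) (c : W → C) :
    rainbowLength G (c ∘ e) = rainbowLength H c := by
  refine congrArg sInf (Set.ext fun k => ⟨?_, ?_⟩)
  · rintro ⟨x, y, z, h, rfl⟩
    exact ⟨e x, e y, e z, h, by simp only [dist_iso]⟩
  · rintro ⟨x, y, z, h, rfl⟩
    refine ⟨e.symm x, e.symm y, e.symm z, ?_, by simp only [dist_iso]⟩
    simpa only [IsRainbow, Function.comp_apply, RelIso.apply_symm_apply] using h

namespace IsExtremalPair

theorem swap (h : IsExtremalPair G c α β γ x z) : IsExtremalPair G c γ β α z x where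
  isRainbowAPFree := h.isRainbowAPFree
  ne_left := h.ne_right.symm
  ne_right := h.ne_left.symm
  ne := h.ne.symm
  color_left := h.color_right
  color_right := h.color_left
  dist_eq := G.dist_comm.trans h.dist_eq
  color_of_between t ht htz htx := by
    refine h.color_of_between t ?_ htx htz
    rw [G.dist_comm (v := t), G.dist_comm (v := z), add_comm, ht, G.dist_comm]

theorem comp_iso (e : G ≃g H) {c : W → C} {x z : W} (h : IsExtremalPair H c α β γ x z) :
    IsExtremalPair G (c ∘ e) α β γ (e.symm x) (e.symm z) where
  isRainbowAPFree u v w huvw :=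
    h.isRainbowAPFree (e u) (e v) (e w) (by rwa [dist_iso, dist_iso])
  ne_left := h.ne_left
  ne_right := h.ne_right
  ne := h.ne
  color_left := by simpa using h.color_left
  color_right := by simpa using h.color_right
  dist_eq := by rw [dist_iso, rainbowLength_comp_iso, h.dist_eq]
  color_of_between t ht htx htz := by
    refine h.color_of_between (e t) ?_ (by rwa [Ne, ← e.eq_symm_apply])
      (by rwa [Ne, ← e.eq_symm_apply])
    rwa [← dist_iso e, ← dist_iso e, ← dist_iso e, e.apply_symm_apply, e.apply_symm_apply] at ht

protected theorem exists_isRainbowGeodesic (hG : HasMedians G)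
    (h : IsExtremalPair G c α β γ x z) : ∃ u w v, IsRainbowGeodesic G c u w v := by
  have hxz : x ≠ z := ne_of_apply_ne c (by rw [h.color_left, h.color_right]; exact h.ne)
  obtain ⟨-, u, w, v, huwv, -⟩ :=
    Nat.nonempty_of_pos_sInf ((hG.connected.pos_dist_of_ne hxz).trans_eq h.dist_eq)
  exact exists_isRainbowGeodesic hG ⟨u, w, v, huwv⟩

theorem odd_rainbowLength (hG : HasMedians G) (h : IsExtremalPair G c α β γ x z) :
    Odd (rainbowLength G c) :=
  let ⟨_, _, _, hg⟩ := h.exists_isRainbowGeodesic hG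
  hg.odd_rainbowLength hG.connected h.isRainbowAPFree

theorem three_le_rainbowLength (hG : HasMedians G) (h : IsExtremalPair G c α β γ x z) :
    3 ≤ rainbowLength G c := by
  obtain ⟨u, w, v, hg⟩ := h.exists_isRainbowGeodesic hG
  have := hg.dist_step_add_one
  have := hG.connected.pos_dist_of_ne hg.isRainbow.ne_right
  obtain ⟨k, hk⟩ := h.odd_rainbowLength hG
  omega

theorem rainbowLength_le_dist (hG : G.Connected) (h : IsExtremalPair G c α β γ x z)
    (hpα : c p ≠ α) (hpβ : c p ≠ β) : rainbowLength G c ≤ G.dist x p := by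
  have hxz := h.dist_eq
  have hxp := hG.pos_dist_of_ne (ne_of_apply_ne c (h.color_left.trans_ne hpα.symm))
  by_contra! hlt
  obtain ⟨s, hxs, hsz⟩ := exists_dist_eq_of_le hG (x := x) (y := z) (s := G.dist x p) (by omega)
  have hs : c s = β := h.color_of_between s (by omega)
    (by rintro rfl; simp only [dist_self] at *; omega) (by rintro rfl; omega)
  refine h.isRainbowAPFree p x s (by rw [G.dist_comm, hxs]) ⟨?_, ?_, ?_⟩
  · rwa [h.color_left]
  · rw [h.color_left, hs]
    exact h.ne_left
  · rwa [hs]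

theorem sphere_of_lt (hG : HasMedians G) (h : IsExtremalPair G c α β γ x z)
    (hxy : G.dist x y = G.dist x z) (hyz : G.dist y z < 2 * G.dist x z) :
    IsExtremalPair G c α β γ x y := by
  by_cases hyz₀ : y = z
  · rwa [hyz₀]
  have hxz := h.dist_eq
  have hlen := h.three_le_rainbowLength hG
  have hyz₁ := hG.connected.pos_dist_of_ne hyz₀
  obtain ⟨t, hxt, hxtz, hyt⟩ := hG.exists_median x y z
  have hty := G.dist_comm (u := t) (v := y)
  have hct : c t = β := h.color_of_between t hxtz
    (by rintro rfl; simp only [dist_self] at *; omega)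
    (by rintro rfl; simp only [dist_self] at *; omega)
  have hcy : c y = γ := by
    by_contra hcy
    have hcyβ : c y ≠ β := fun hcyβ => h.isRainbowAPFree y x z (by rw [G.dist_comm, hxy]) <| by
      simpa only [IsRainbow, hcyβ, h.color_left, h.color_right] using
        ⟨h.ne_left.symm, h.ne, h.ne_right⟩
    exact h.isRainbowAPFree y t z (by omega) <| by
      simpa only [IsRainbow, hct, h.color_right] using ⟨hcyβ, h.ne_right, hcy⟩
  obtain ⟨w, hxw, hwt⟩ := exists_dist_eq_of_le hG.connected (x := x) (y := t) (s := 1)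
    (by omega)
  have hwy := hG.connected.dist_triangle (u := w) (v := t) (w := y)
  have hxwy := hG.connected.dist_triangle (u := x) (v := w) (w := y)
  have hwz := hG.connected.dist_triangle (u := w) (v := t) (w := z)
  have hxwz := hG.connected.dist_triangle (u := x) (v := w) (w := z)
  have hcw : c w = β := h.color_of_between w (by omega) (by rintro rfl; simp at hxw)
    (by rintro rfl; omega)
  have hg : IsRainbowGeodesic G c x w y :=
    ⟨by simpa only [IsRainbow, hcw, hcy, h.color_left] using ⟨h.ne_left, h.ne_right, h.ne⟩,
      hxw, by omega, by omega⟩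
  exact ⟨h.isRainbowAPFree, h.ne_left, h.ne_right, h.ne, h.color_left, hcy, by omega,
    fun s hs hsx hsy => (hg.color_eq_of_between hG h.isRainbowAPFree hs hsx hsy).trans hcw⟩

end IsExtremalPair

end RainbowLength

section Product

variable {V W C : Type*} {G : SimpleGraph V} {H : SimpleGraph W} {c : V × W → C}
  {α β γ : C} {x y z : V × W}

namespace IsExtremalPair

theorem swapFactors (h : IsExtremalPair (G □ H) c α β γ x z) :
    IsExtremalPair (H □ G) (c ∘ Prod.swap) α β γ x.swap z.swap :=
  h.comp_iso (boxProdComm H G)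

theorem dist_add_dist (hG : G.Connected) (hH : H.Connected)
    (h : IsExtremalPair (G □ H) c α β γ x z) :
    G.dist x.1 z.1 + H.dist x.2 z.2 = rainbowLength (G □ H) c := by
  rw [← dist_boxProd hG hH, h.dist_eq]

/-- If the pair lay in one fibre, the inner vertices next to its ends could be moved to a
neighbouring fibre, where one of them would have to take two colors. -/
theorem dist_snd_pos [Nontrivial W] (hG : HasMedians G) (hH : HasMedians H)
    (h : IsExtremalPair (G □ H) c α β γ x z) : 0 < H.dist x.2 z.2 := by
  have dist_eq := dist_boxProd hG.connected hH.connected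
  have hlen := h.three_le_rainbowLength (hG.boxProd hH)
  have hxz := h.dist_add_dist hG.connected hH.connected
  by_contra! hzero
  have hsnd : z.2 = x.2 := (hH.connected.dist_eq_zero_iff.1 (by omega)).symm
  obtain ⟨w, hw⟩ := exists_ne x.2
  obtain ⟨v, hxv, -⟩ := exists_dist_eq_of_le hH.connected (s := 1)
    (hH.connected.pos_dist_of_ne hw.symm)
  have hvx := H.dist_comm (u := v) (v := x.2)
  obtain ⟨a, hxa, haz⟩ := exists_dist_eq_of_le hG.connected (x := x.1) (y := z.1) (s := 1)
    (by omega)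
  obtain ⟨b, hab, hbz⟩ := exists_dist_eq_of_le hG.connected (x := a) (y := z.1)
    (s := rainbowLength (G □ H) c - 2) (by omega)
  have hxab := hG.connected.dist_triangle (u := x.1) (v := a) (w := b)
  have hxbz := hG.connected.dist_triangle (u := x.1) (v := b) (w := z.1)
  have hza := G.dist_comm (u := z.1) (v := a)
  have hzx := G.dist_comm (u := z.1) (v := x.1)
  have hax := G.dist_comm (u := a) (v := x.1)
  have hb : IsExtremalPair (G □ H) c α β γ x (b, v) := by
    apply h.sphere_of_lt (hG.boxProd hH) <;> simp only [dist_eq, hsnd, dist_self] <;> omega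
  have ha : IsExtremalPair (G □ H) c γ β α z (a, v) := by
    apply h.swap.sphere_of_lt (hG.boxProd hH) <;> simp only [dist_eq, hsnd, dist_self] <;> omega
  refine h.ne_left (ha.color_right.symm.trans (hb.color_of_between _ ?_ ?_ ?_))
  · simp only [dist_eq, dist_self]
    omega
  · rintro rfl
    simp only [dist_self] at hxv
    omega
  · simp only [ne_eq, Prod.mk.injEq, and_true]
    rintro rfl
    simp only [dist_self] at hab
    omega

theorem dist_fst_pos [Nontrivial V] (hG : HasMedians G) (hH : HasMedians H)
    (h : IsExtremalPair (G □ H) c α β γ x z) : 0 < G.dist x.1 z.1 :=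
  h.swapFactors.dist_snd_pos hH hG

theorem sphere_of_dist_snd_le [Nontrivial V] [Nontrivial W] (hG : HasMedians G)
    (hH : HasMedians H) (h : IsExtremalPair (G □ H) c α β γ x z)
    (hxy : (G □ H).dist x y = rainbowLength (G □ H) c) (hle : H.dist x.2 z.2 ≤ H.dist x.2 y.2) :
    IsExtremalPair (G □ H) c α β γ x y := by
  have dist_eq := dist_boxProd hG.connected hH.connected
  have hxz := h.dist_add_dist hG.connected hH.connected
  have hfst := h.dist_fst_pos hG hH
  have hsnd := h.dist_snd_pos hG hH
  rw [dist_eq] at hxy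
  obtain ⟨w, hxw, hwy⟩ := exists_dist_eq_of_le hH.connected hle
  have hwxz := hH.connected.dist_triangle (u := w) (v := x.2) (w := z.2)
  have hyxz := hG.connected.dist_triangle (u := y.1) (v := x.1) (w := z.1)
  have hwx := H.dist_comm (u := w) (v := x.2)
  have hyw := H.dist_comm (u := y.2) (v := w)
  have hyx := G.dist_comm (u := y.1) (v := x.1)
  have hzw : IsExtremalPair (G □ H) c α β γ x (z.1, w) := by
    apply h.sphere_of_lt (hG.boxProd hH) <;> simp only [dist_eq, dist_self] <;> omega
  apply hzw.sphere_of_lt (hG.boxProd hH) <;> simp only [dist_eq] <;> omega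

theorem sphere [Nontrivial V] [Nontrivial W] (hG : HasMedians G)
    (hH : HasMedians H) (h : IsExtremalPair (G □ H) c α β γ x z)
    (hxy : G.dist x.1 y.1 + H.dist x.2 y.2 = rainbowLength (G □ H) c) :
    IsExtremalPair (G □ H) c α β γ x y := by
  have hxz := h.dist_add_dist hG.connected hH.connected
  rw [← dist_boxProd hG.connected hH.connected] at hxy
  rcases le_total (H.dist x.2 z.2) (H.dist x.2 y.2) with hle | hle
  · exact h.sphere_of_dist_snd_le hG hH hxy hle
  · refine (h.swapFactors.sphere_of_dist_snd_le (y := y.swap) hH hG ?_ ?_).swapFactors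
    · exact (dist_iso (boxProdComm G H) x y).trans
        (hxy.trans (rainbowLength_comp_iso (boxProdComm H G) c).symm)
    · rw [dist_boxProd hG.connected hH.connected] at hxy
      change G.dist x.1 z.1 ≤ G.dist x.1 y.1
      omega

theorem sphere_left [Nontrivial V] [Nontrivial W] (hG : HasMedians G)
    (hH : HasMedians H) (h : IsExtremalPair (G □ H) c α β γ x z)
    (hyz : G.dist y.1 z.1 + H.dist y.2 z.2 = rainbowLength (G □ H) c) :
    IsExtremalPair (G □ H) c α β γ y z :=
  (h.swap.sphere hG hH (by rwa [G.dist_comm, H.dist_comm])).swap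

theorem exists_fst_eq_diam [Nontrivial V] [Nontrivial W] (hG : G.IsTree) (hGd : G.ediam ≠ ⊤)
    (hH : HasMedians H) {x z : V × W} (h : IsExtremalPair (G □ H) c α β γ x z) :
    ∃ x z, IsExtremalPair (G □ H) c α β γ x z ∧ G.dist x.1 z.1 = G.diam := by
  have hxz := h.dist_add_dist hG.connected hH.connected
  have hsnd := h.dist_snd_pos (.of_isTree hG) hH
  rcases (dist_le_diam hGd : G.dist x.1 z.1 ≤ G.diam).eq_or_lt with heq | hlt
  · exact ⟨x, z, h, heq⟩
  rcases exists_dist_eq_succ hG hlt with ⟨w, hw⟩ | ⟨w, hw⟩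
  · obtain ⟨s, hs, -⟩ := exists_dist_eq_of_le hH.connected (Nat.sub_le (H.dist x.2 z.2) 1)
    exact (h.sphere (.of_isTree hG) hH (y := (w, s))
      (by dsimp only; omega)).exists_fst_eq_diam hG hGd hH
  · obtain ⟨s, -, hs⟩ := exists_dist_eq_of_le hH.connected (x := x.2) (y := z.2) (s := 1) hsnd
    have hwz := G.dist_comm (u := w) (v := z.1)
    exact (h.sphere_left (.of_isTree hG) hH (y := (w, s))
      (by dsimp only; omega)).exists_fst_eq_diam hG hGd hH
termination_by G.diam - G.dist x.1 z.1
decreasing_by all_goals omega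

/-- A vertex of a fourth color is at distance at least `rainbowLength` from all ends of extremal
pairs; but among these one can walk towards it in the second factor. -/
theorem color_eq [Nontrivial V] [Nontrivial W] (hG : HasMedians G) (hGd : G.ediam ≠ ⊤)
    (hH : HasMedians H) {α γ : C} {x z : V × W} (h : IsExtremalPair (G □ H) c α β γ x z)
    (hd : G.dist x.1 z.1 = G.diam) (p : V × W) : c p = α ∨ c p = β ∨ c p = γ := by
  by_contra! hp
  have hxz := h.dist_add_dist hG.connected hH.connected
  have := h.dist_snd_pos hG hH
  have hxp := h.rainbowLength_le_dist (hG.boxProd hH).connected hp.1 hp.2.1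
  have hfst : G.dist x.1 p.1 ≤ G.diam := dist_le_diam hGd
  rw [dist_boxProd hG.connected hH.connected] at hxp
  obtain ⟨w, hxw, _⟩ := exists_dist_eq_of_le hH.connected (x := x.2) (y := p.2)
    (s := H.dist x.2 z.2) (by omega)
  have hw := (h.sphere hG hH (y := (z.1, w)) (by dsimp only; omega)).swap
  rcases hw.color_eq hG hGd hH (G.dist_comm.trans hd) p with hc | hc | hc
  exacts [hp.2.2 hc, hp.2.1 hc, hp.1 hc]
termination_by H.dist x.2 p.2
decreasing_by omega

end IsExtremalPair

/-- An obstruction of the pair `u`, `u'` at distance `diam G`: a vertex at distance `diam G - 1`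
from `u` and at least `diam G - 1` from `u'`. -/
def IsObstruction (G : SimpleGraph V) (u u' p : V) : Prop :=
  G.dist u p + 1 = G.diam ∧ G.diam ≤ G.dist u' p + 1

/-- Some pair at distance `diam G` has no obstruction. Among the non-`3`-peripheral trees other than
`P₂` this holds exactly for the strongly non-`3`-peripheral ones. -/
def HasUnobstructedPair (G : SimpleGraph V) : Prop :=
  ∃ u u', G.dist u u' = G.diam ∧ ∀ p, ¬ IsObstruction G u u' p

namespace IsExtremalPair

theorem not_isObstruction [Nontrivial V] [Nontrivial W] (hG : HasMedians G) (hGd : G.ediam ≠ ⊤)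
    (hH : HasMedians H) (h : IsExtremalPair (G □ H) c α β γ x z)
    (hd : G.dist x.1 z.1 = G.diam) {w : W} (hw : H.dist x.2 w = H.dist x.2 z.2 + 1) (p : V) :
    ¬ IsObstruction G x.1 z.1 p := by
  rintro ⟨hxp, hzp⟩
  have dist_eq := dist_boxProd hG.connected hH.connected
  have hxz := h.dist_add_dist hG.connected hH.connected
  have hzp_le : G.dist z.1 p ≤ G.diam := dist_le_diam hGd
  have hpw := h.sphere hG hH (y := (p, w)) (by dsimp only; omega)
  have hpos := hpw.dist_fst_pos hG hH
  dsimp only at hpos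
  obtain ⟨q, hxq, hqw⟩ := exists_dist_eq_of_le hH.connected (x := x.2) (y := w)
    (s := G.dist z.1 p + 1 - G.diam) (by omega)
  have hq := hpw.sphere_left hG hH (y := (z.1, q)) (by dsimp only; omega)
  have hle := h.swap.rainbowLength_le_dist (hG.boxProd hH).connected (p := (z.1, q))
    (hq.color_left.trans_ne h.ne) (hq.color_left.trans_ne h.ne_left)
  simp only [dist_eq, dist_self] at hle
  have hzq := hH.connected.dist_triangle (u := z.2) (v := x.2) (w := q)
  have hzx := H.dist_comm (u := z.2) (v := x.2)
  omega

theorem hasUnobstructedPair [Nontrivial V] [Nontrivial W] (hG : G.IsTree) (hGd : G.ediam ≠ ⊤)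
    (hH : H.IsTree) (hHd : H.ediam ≠ ⊤) (heven : Even (G.diam + H.diam))
    (h : IsExtremalPair (G □ H) c α β γ x z) : HasUnobstructedPair G := by
  have hGm := HasMedians.of_isTree hG
  have hHm := HasMedians.of_isTree hH
  obtain ⟨x, z, h, hd⟩ := h.exists_fst_eq_diam hG hGd hHm
  have hxz := h.dist_add_dist hG.connected hH.connected
  have hsnd : H.dist x.2 z.2 ≤ H.diam := dist_le_diam hHd
  have hlt : H.dist x.2 z.2 < H.diam := by
    obtain ⟨k, hk⟩ := h.odd_rainbowLength (hGm.boxProd hHm)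
    obtain ⟨l, hl⟩ := heven
    omega
  rcases exists_dist_eq_succ hH hlt with ⟨w, hw⟩ | ⟨w, hw⟩
  · exact ⟨x.1, z.1, hd, h.not_isObstruction hGm hGd hHm hd hw⟩
  · have hzx := G.dist_comm.trans hd
    exact ⟨z.1, x.1, hzx, h.swap.not_isObstruction hGm hGd hHm hzx
      (hw.trans (congrArg (· + 1) H.dist_comm))⟩

end IsExtremalPair

end Product

section PolarPair

variable {V W : Type*} {G : SimpleGraph V} {H : SimpleGraph W} {u u' : V} {v v' : W}

theorem dist_lt_of_forall_not_isObstruction [Nontrivial V] (hG : G.Connected) (hGd : G.ediam ≠ ⊤)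
    (h : ∀ p, ¬ IsObstruction G u u' p) {p : V} (hp : G.diam ≤ G.dist u p + 1) :
    G.dist u' p < G.dist u p := by
  have hle : G.dist u p ≤ G.diam := dist_le_diam hGd
  rcases hp.eq_or_lt with heq | hlt
  · have := h p
    simp only [IsObstruction, not_and] at this
    omega
  · have hd := diam_ne_zero_of_ediam_ne_top hGd
    obtain ⟨s, hus, hsp⟩ := exists_dist_eq_of_le hG (x := u) (y := p) (s := G.diam - 1) (by omega)
    have hs := h s
    simp only [IsObstruction, not_and] at hs
    have := hG.dist_triangle (u := u') (v := s) (w := p)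
    omega

theorem dist_add_two_le_of_forall_not_isObstruction [Nontrivial V] (hG : G.Connected)
    (hGd : G.ediam ≠ ⊤) (h : ∀ p, ¬ IsObstruction G u u' p) {p : V}
    (hp : G.dist p u' = G.diam) : G.dist p u + 2 ≤ G.diam := by
  have hle : G.dist p u ≤ G.diam := dist_le_diam hGd
  have := mt (dist_lt_of_forall_not_isObstruction hG hGd h (p := p))
  have := G.dist_comm (u := u) (v := p)
  have := G.dist_comm (u := u') (v := p)
  omega

/-- The vertices at distance `diam G` from `u'` cannot be told apart from `u` by large distances,
and they are the only such vertices. These properties are inherited by products. -/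
structure IsPolarPair (G : SimpleGraph V) (u u' : V) : Prop where
  dist_eq : G.dist u u' = G.diam
  dist_eq_of_pole : ∀ p q, G.dist p u' = G.diam → G.diam ≤ G.dist p q + 1 →
    G.dist p q = G.dist u q
  dist_le : ∀ p q, G.diam ≤ G.dist u q + 1 → G.dist p q ≤ G.dist u q
  dist_eq_iff : ∀ p q, G.diam ≤ G.dist u q + 1 →
    (G.dist p q = G.dist u q ↔ G.dist p u' = G.diam)

namespace IsPolarPair

theorem of_forall_not_isObstruction [Nontrivial V] (hG : G.IsTree) (hGd : G.ediam ≠ ⊤)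
    (hu : G.dist u u' = G.diam) (h : ∀ p, ¬ IsObstruction G u u' p) : IsPolarPair G u u' := by
  have hlt : ∀ {p}, G.diam ≤ G.dist u p + 1 → G.dist u' p < G.dist u p :=
    dist_lt_of_forall_not_isObstruction hG.connected hGd h
  have hle : ∀ a b, G.dist a b ≤ G.diam := fun _ _ => dist_le_diam hGd
  have dist_pole_le : ∀ {p}, G.dist p u' = G.diam → G.dist p u + 2 ≤ G.diam :=
    dist_add_two_le_of_forall_not_isObstruction hG.connected hGd h
  have le_dist_pole : ∀ {p q}, G.dist p u' = G.diam → G.diam ≤ G.dist u q + 1 →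
      G.dist u q ≤ G.dist p q := fun {p q} hp hq => by
    have := dist_add_dist_le_or hG p u' u q
    have := dist_pole_le hp
    have := hle u' q
    have := G.dist_comm (u := u') (v := u)
    omega
  have dist_add_le : ∀ p q, G.dist p q + G.diam ≤ G.dist p u + G.dist u' q ∨
      G.dist p q + G.diam ≤ G.dist p u' + G.dist u q := fun p q => by
    have := dist_add_dist_le_or hG p q u u'
    have := G.dist_comm (u := u') (v := q)
    have := G.dist_comm (u := u) (v := q)
    omega
  refine ⟨hu, fun p q hp hpq => ?_, fun p q hq => ?_, fun p q hq => ⟨fun hpq => ?_, fun hp => ?_⟩⟩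
  · have := dist_add_le p q
    have := dist_pole_le hp
    have := hle u' q
    have := hle u q
    exact le_antisymm (by omega) (le_dist_pole hp (by omega))
  · have := dist_add_le p q
    have := hlt hq
    have := hle p u
    have := hle p u'
    omega
  · have := dist_add_le p q
    have := hlt hq
    have := hle p u
    have := hle p u'
    omega
  · have := dist_add_le p q
    have := hlt hq
    have := hle p u
    exact le_antisymm (by omega) (le_dist_pole hp hq)

theorem boxProd (hG : G.Connected) (hGd : G.ediam ≠ ⊤) (hH : H.Connected) (hHd : H.ediam ≠ ⊤)
    (h : IsPolarPair G u u') (h' : IsPolarPair H v v') :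
    IsPolarPair (G □ H) (u, v) (u', v') := by
  have hle : ∀ a b, G.dist a b ≤ G.diam := fun _ _ => dist_le_diam hGd
  have hle' : ∀ a b, H.dist a b ≤ H.diam := fun _ _ => dist_le_diam hHd
  constructor <;> simp only [Prod.forall, dist_boxProd hG hH, diam_boxProd hG hH hGd hHd]
  · rw [h.dist_eq, h'.dist_eq]
  · intro p p' q q' hp hpq
    have := hle p u'
    have := hle' p' v'
    have := hle p q
    have := hle' p' q'
    rw [h.dist_eq_of_pole p q (by omega) (by omega),
      h'.dist_eq_of_pole p' q' (by omega) (by omega)]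
  · intro p p' q q' hq
    have := hle u q
    have := hle' v q'
    exact add_le_add (h.dist_le p q (by omega)) (h'.dist_le p' q' (by omega))
  · intro p p' q q' hq
    have := hle u q
    have := hle' v q'
    have := h.dist_le p q (by omega)
    have := h'.dist_le p' q' (by omega)
    have := h.dist_eq_iff p q (by omega)
    have := h'.dist_eq_iff p' q' (by omega)
    have := hle p u'
    have := hle' p' v'
    omega

end IsPolarPair

/-- The coloring of the vertices by `0` at distance `diam G` from `u'`, by `1` at distance
`diam G - 1` from `u` and by `2` elsewhere. -/
noncomputable def polarColoring (G : SimpleGraph V) (u u' x : V) : Fin 3 :=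
  if G.dist x u' = G.diam then 0 else if G.dist u x + 1 = G.diam then 1 else 2

theorem polarColoring_eq_zero {x : V} : polarColoring G u u' x = 0 ↔ G.dist x u' = G.diam := by
  unfold polarColoring
  split_ifs <;> simp_all

theorem polarColoring_eq_one {x : V} :
    polarColoring G u u' x = 1 ↔ G.dist x u' ≠ G.diam ∧ G.dist u x + 1 = G.diam := by
  unfold polarColoring
  split_ifs <;> simp_all

theorem polarColoring_surjective (hG : G.Connected) (hd : 2 ≤ G.diam) (h : G.dist u u' = G.diam) :
    (polarColoring G u u').Surjective := by
  obtain ⟨w, huw, hwu'⟩ := exists_dist_eq_of_le hG (x := u) (y := u') (s := G.diam - 1) (by omega)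
  refine Fin.forall_fin_succ.2 ⟨⟨u, polarColoring_eq_zero.2 h⟩, Fin.forall_fin_two.2
    ⟨⟨w, polarColoring_eq_one.2 ⟨by omega, by omega⟩⟩, u', ?_⟩⟩
  rw [polarColoring, dist_self, if_neg (by omega), if_neg (by omega)]
  rfl

theorem IsPolarPair.isRainbowAPFree_polarColoring (hG : HasMedians G) (heven : Even G.diam)
    (h : IsPolarPair G u u') : IsRainbowAPFree G (polarColoring G u u') := by
  set c := polarColoring G u u'
  have color_one_of_zero : ∀ {x y z}, G.dist y x = G.dist y z → c y = 0 → c x = 1 →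
      c z = 0 ∨ c z = 1 := fun {x y z} hxz hy hx => by
    rw [polarColoring_eq_zero] at hy
    rw [polarColoring_eq_one] at hx
    have hyx := (h.dist_eq_iff y x (by omega)).2 hy
    have hyz := h.dist_eq_of_pole y z hy (by omega)
    exact or_iff_not_imp_left.2 fun hz =>
      polarColoring_eq_one.2 ⟨mt polarColoring_eq_zero.2 hz, by omega⟩
  have color_zero_of_one : ∀ {x y z}, G.dist y x = G.dist y z → c y = 1 → c x = 0 →
      c z = 0 := fun {x y z} hxz hy hx => by
    rw [polarColoring_eq_zero] at hx ⊢
    rw [polarColoring_eq_one] at hy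
    have hxy := (h.dist_eq_iff x y (by omega)).2 hx
    exact (h.dist_eq_iff z y (by omega)).1 (by rw [G.dist_comm, ← hxz, G.dist_comm, hxy])
  have not_zero_one : ∀ {x y z}, G.dist y x = G.dist y z → c x = 0 → c z ≠ 1 :=
      fun {x y z} hxz hx hz => by
    rw [polarColoring_eq_zero] at hx
    rw [polarColoring_eq_one] at hz
    have := (h.dist_eq_iff x z (by omega)).2 hx
    have := G.dist_comm (u := x) (v := y)
    obtain ⟨k, hk⟩ := hG.even_dist_add x y z
    obtain ⟨l, hl⟩ := heven
    omega
  intro x y z hxyz ⟨hxy, hyz, hxz⟩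
  rw [G.dist_comm] at hxyz
  have h₁ := color_one_of_zero hxyz
  have h₂ := color_one_of_zero hxyz.symm
  have h₃ := color_zero_of_one hxyz
  have h₄ := color_zero_of_one hxyz.symm
  have h₅ := not_zero_one hxyz
  have h₆ := not_zero_one hxyz.symm
  omega

end PolarPair

section Number

variable {V W : Type*} {G : SimpleGraph V} {H : SimpleGraph W}

theorem exists_isExtremalPair_of_surjective (hG : HasMedians G) {r : ℕ} (hr : 3 ≤ r)
    {c : V → Fin r} (hc : c.Surjective) (hcG : ¬ HasRainbowAP G 3 c) :
    ∃ α β γ x z, IsExtremalPair G c α β γ x z := by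
  obtain ⟨x, hx⟩ := hc ⟨0, by omega⟩
  obtain ⟨y, hy⟩ := hc ⟨1, by omega⟩
  obtain ⟨z, hz⟩ := hc ⟨2, by omega⟩
  exact exists_isExtremalPair hG ((not_hasRainbowAP_three_iff hG.connected).1 hcG)
    ⟨x, y, z, by simp [IsRainbow, hx, hy, hz]⟩

variable [Nontrivial V] [Nontrivial W]

theorem aw_boxProd_eq_three (hG : G.IsTree) (hGd : G.ediam ≠ ⊤) (hH : H.IsTree)
    (hHd : H.ediam ≠ ⊤) (heven : Even (G.diam + H.diam))
    (h : ¬ (HasUnobstructedPair G ∧ HasUnobstructedPair H)) : aw (G □ H) 3 = 3 := by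
  refine aw_eq_three fun c hc => by_contra fun hcGH => h ?_
  obtain ⟨_, _, _, _, _, hxz⟩ := exists_isExtremalPair_of_surjective
    ((HasMedians.of_isTree hG).boxProd (.of_isTree hH)) le_rfl hc hcGH
  exact ⟨hxz.hasUnobstructedPair hG hGd hH hHd heven,
    hxz.swapFactors.hasUnobstructedPair hH hHd hG hGd (by rwa [add_comm])⟩

theorem hasRainbowAP_boxProd_of_four_le (hG : G.IsTree) (hGd : G.ediam ≠ ⊤) (hH : HasMedians H)
    {r : ℕ} (hr : 4 ≤ r) {c : V × W → Fin r} (hc : c.Surjective) : HasRainbowAP (G □ H) 3 c := by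
  by_contra hcGH
  obtain ⟨_, _, _, _, _, h⟩ := exists_isExtremalPair_of_surjective
    ((HasMedians.of_isTree hG).boxProd hH) (by omega) hc hcGH
  obtain ⟨x, z, h, hd⟩ := h.exists_fst_eq_diam hG hGd hH
  have hcard := Fintype.card_le_of_surjective (![_, _, _] : Fin 3 → Fin r) fun i => by
    obtain ⟨p, rfl⟩ := hc i
    rcases h.color_eq (.of_isTree hG) hGd hH hd p with hp | hp | hp
    exacts [⟨0, hp.symm⟩, ⟨1, hp.symm⟩, ⟨2, hp.symm⟩]
  simp only [Fintype.card_fin] at hcard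
  omega

theorem aw_boxProd_eq_four (hG : G.IsTree) (hGd : G.ediam ≠ ⊤) (hH : H.IsTree)
    (hHd : H.ediam ≠ ⊤) (heven : Even (G.diam + H.diam)) (h : HasUnobstructedPair G)
    (h' : HasUnobstructedPair H) : aw (G □ H) 3 = 4 := by
  obtain ⟨u, u', hu, hfree⟩ := h
  obtain ⟨v, v', hv, hfree'⟩ := h'
  have hpole := (IsPolarPair.of_forall_not_isObstruction hG hGd hu hfree).boxProd hG.connected hGd
    hH.connected hHd (.of_forall_not_isObstruction hH hHd hv hfree')
  have hGH := (HasMedians.of_isTree hG).boxProd (.of_isTree hH)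
  have hdiam := diam_boxProd hG.connected hH.connected hGd hHd
  have hd := diam_ne_zero_of_ediam_ne_top hGd
  have hd' := diam_ne_zero_of_ediam_ne_top hHd
  exact aw_eq_four (fun c => hasRainbowAP_boxProd_of_four_le hG hGd (.of_isTree hH) le_rfl)
    (polarColoring_surjective hGH.connected (by omega) hpole.dist_eq)
    ((not_hasRainbowAP_three_iff hGH.connected).2
      (hpole.isRainbowAPFree_polarColoring hGH (hdiam ▸ heven)))

end Number

section Peripheral

variable {V : Type*} {G T : SimpleGraph V}

theorem isPeripheral_three_iff (hd : G.diam ≠ 0) : IsPeripheral G 3 ↔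
    ∃ x y z, G.dist x y = G.diam ∧ G.dist x z = G.diam ∧ G.dist y z = G.diam := by
  constructor
  · rintro ⟨f, -, h⟩
    exact ⟨f 0, f 1, f 2, h _ _ (by decide), h _ _ (by decide), h _ _ (by decide)⟩
  · rintro ⟨x, y, z, hxy, hxz, hyz⟩
    have h : ∀ i j : Fin 3, i ≠ j → G.dist (![x, y, z] i) (![x, y, z] j) = G.diam := by
      intro i j hij
      fin_cases i <;> fin_cases j <;> simp_all [G.dist_comm]
    refine ⟨![x, y, z], fun i j hij => by_contra fun hne => hd ?_, h⟩
    rw [← h i j hne, hij, dist_self]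

theorem isPeripheralVertex_iff (hG : G.Connected) (hd : G.ediam ≠ ⊤) {v : V} :
    IsPeripheralVertex G v ↔ ∃ w, G.dist v w = G.diam := by
  have hediam : (G.diam : ℕ∞) = G.ediam := ENat.natCast_toNat hd
  have hdist : ∀ w, (G.dist v w : ℕ∞) = G.edist v w := fun w => (hG v w).coe_dist_eq_edist
  have := hG.nonempty
  constructor
  · intro hv
    obtain ⟨w, hw⟩ := ENat.exists_eq_iSup_of_lt_top (f := G.edist v)
      (lt_top_iff_ne_top.2 (ne_of_eq_of_ne hv hd))
    exact ⟨w, Nat.cast_injective ((hdist w).trans ((hw.trans hv).trans hediam.symm))⟩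
  · rintro ⟨w, hw⟩
    refine le_antisymm eccent_le_ediam ?_
    rw [← hediam, ← hw, hdist]
    exact edist_le_eccent

theorem isP2_iff_diam_eq_one [Nontrivial V] (hT : T.IsTree) : IsP2 T ↔ T.diam = 1 := by
  rw [diam_eq_one, IsP2, pathGraph_two_eq_top]
  constructor
  · rintro ⟨e⟩
    ext a b
    rw [← e.map_adj_iff, top_adj, top_adj, e.injective.ne_iff]
  · rintro rfl
    obtain ⟨a, b, hab⟩ := exists_pair_ne V
    have hcard : Nat.card V = 2 := by
      refine Nat.card_eq_two_iff.2 ⟨a, b, hab, Set.eq_univ_of_forall fun x => ?_⟩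
      by_contra! hx
      simp only [Set.mem_insert_iff, Set.mem_singleton_iff, not_or] at hx
      have hdist : ∀ {x y : V}, x ≠ y → (⊤ : SimpleGraph V).dist x y = 1 :=
        fun hxy => dist_eq_one_iff_adj.2 hxy
      obtain ⟨k, hk⟩ := (HasMedians.of_isTree hT).even_dist_add a b x
      rw [hdist hab, hdist (Ne.symm hx.1), hdist (Ne.symm hx.2)] at hk
      omega
    have := Nat.finite_of_card_ne_zero (hcard.trans_ne two_ne_zero)
    exact ⟨⟨Finite.equivFinOfCardEq hcard, by simp⟩⟩

end Peripheral

section AddLeaf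

variable {V : Type*} {T : SimpleGraph V} {u : V}

/-- The inclusion of a graph into the graph with an additional leaf. -/
def addLeafHom (T : SimpleGraph V) (u : V) : T →g addLeaf T u := ⟨some, fun h => h⟩

theorem addLeaf_connected (hT : T.Connected) (u : V) : (addLeaf T u).Connected := by
  refine (connected_iff_exists_forall_reachable _).2 ⟨some u, ?_⟩
  rintro (_ | a)
  · exact Adj.reachable (G := addLeaf T u) (show u = u from rfl)
  · exact (hT u a).map (addLeafHom T u)

theorem dist_addLeaf (hT : T.Connected) (a : V) (y : Option V) :
    (addLeaf T u).dist (some a) y = y.elim (T.dist a u + 1) (T.dist a) := by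
  have hC := addLeaf_connected hT u
  have dist_some_le : ∀ b, (addLeaf T u).dist (some a) (some b) ≤ T.dist a b := fun b =>
    ENat.toNat_le_toNat (edist_map_le (addLeafHom T u) a b) (edist_ne_top_iff_reachable.2 (hT a b))
  refine le_antisymm ?_ ?_
  · rcases y with _ | b
    · have hu : (addLeaf T u).dist (some u) none = 1 :=
        dist_eq_one_iff_adj.2 (show u = u from rfl)
      have := hC.dist_triangle (u := some a) (v := some u) (w := none)
      have := dist_some_le u
      simp only [Option.elim]
      omega
    · exact dist_some_le b
  · refine (le_add_dist hC (f := fun y => y.elim (T.dist a u + 1) (T.dist a)) ?_ (some a)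
      y).trans_eq (by simp only [Option.elim, dist_self, zero_add])
    rintro (_ | x) (_ | y) h
    · exact h.elim
    · obtain rfl : y = u := h
      simp only [Option.elim]
      omega
    · obtain rfl : x = u := h
      exact le_rfl
    · have hxy : T.dist x y = 1 := dist_eq_one_iff_adj.2 h
      exact hT.dist_triangle.trans_eq (congrArg (T.dist a x + ·) hxy)

theorem dist_addLeaf_le (hT : T.Connected) {k : ℕ} (hk : ∀ a b, T.dist a b ≤ k)
    (hu : ∀ a, T.dist a u + 1 ≤ k) (x y : Option V) : (addLeaf T u).dist x y ≤ k := by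
  have hsome : ∀ a y, (addLeaf T u).dist (some a) y ≤ k := by
    rintro a (_ | b) <;> rw [dist_addLeaf hT]
    exacts [hu a, hk a b]
  rcases x with _ | a
  · rcases y with _ | b
    · simp
    · rw [SimpleGraph.dist_comm]
      exact hsome b _
  · exact hsome a y

theorem ediam_addLeaf_ne_top (hT : T.Connected) (hTd : T.ediam ≠ ⊤) :
    (addLeaf T u).ediam ≠ ⊤ :=
  ediam_ne_top_of_forall_dist_le (addLeaf_connected hT u) <| dist_addLeaf_le hT (k := T.diam + 1)
    (fun _ _ => (dist_le_diam hTd).trans (Nat.le_succ _))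
    fun _ => Nat.succ_le_succ (dist_le_diam hTd)

theorem diam_le_diam_addLeaf (hT : T.Connected) (hTd : T.ediam ≠ ⊤) :
    T.diam ≤ (addLeaf T u).diam := by
  have := hT.nonempty
  obtain ⟨a, b, hab⟩ := T.exists_dist_eq_diam
  rw [← hab]
  exact (dist_addLeaf hT a (some b)).symm.trans_le (dist_le_diam (ediam_addLeaf_ne_top hT hTd))

end AddLeaf

section RemoveFar

variable {V : Type*} {T : SimpleGraph V} {s : Set V} {u u' : V}

theorem exists_walk_induce_length_eq_dist (hT : T.Connected)
    (hs : ∀ x ∈ s, ∀ y ∈ s, ∀ z, T.dist x z + T.dist z y = T.dist x y → z ∈ s) (x y : s) :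
    ∃ p : (T.induce s).Walk x y, p.length = T.dist x y := by
  classical
  obtain ⟨p, hp⟩ := hT.exists_walk_length_eq_dist (x : V) (y : V)
  have hmem : ∀ z ∈ p.support, z ∈ s := fun z hz => by
    refine hs x x.2 y y.2 z (le_antisymm ?_ hT.dist_triangle)
    rw [← hp, ← congrArg Walk.length (p.take_spec hz), Walk.length_append]
    exact add_le_add (dist_le _) (dist_le _)
  exact ⟨p.induce s hmem,
    (Walk.length_map _ _).symm.trans ((congrArg Walk.length (p.map_induce hmem)).trans hp)⟩

theorem dist_induce_eq_dist (hT : T.Connected)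
    (hs : ∀ x ∈ s, ∀ y ∈ s, ∀ z, T.dist x z + T.dist z y = T.dist x y → z ∈ s) (x y : s) :
    (T.induce s).dist x y = T.dist x y := by
  obtain ⟨p, hp⟩ := exists_walk_induce_length_eq_dist hT hs x y
  exact le_antisymm (hp ▸ dist_le p) (ENat.toNat_le_toNat
    (edist_map_le (Embedding.induce s).toHom x y) (edist_ne_top_iff_reachable.2 p.reachable))

theorem dist_ne_diam_of_between (hT : T.IsTree) (hTd : T.ediam ≠ ⊤) {x y z : V}
    (hx : T.dist u x ≠ T.diam) (hy : T.dist u y ≠ T.diam)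
    (hz : T.dist x z + T.dist z y = T.dist x y) : T.dist u z ≠ T.diam := by
  have := dist_add_dist_le_or hT u z x y
  have : T.dist u x ≤ T.diam := dist_le_diam hTd
  have : T.dist u y ≤ T.diam := dist_le_diam hTd
  have := T.dist_comm (u := x) (v := z)
  omega

theorem dist_removeFar (hT : T.IsTree) (hTd : T.ediam ≠ ⊤)
    (x y : {w : V | T.dist u w ≠ T.diam}) : (removeFar T u).dist x y = T.dist x y :=
  dist_induce_eq_dist hT.connected
    (fun _ hx _ hy _ => dist_ne_diam_of_between hT hTd hx hy) x y

theorem removeFar_connected (hT : T.IsTree) (hTd : T.ediam ≠ ⊤) (hd : T.diam ≠ 0) :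
    (removeFar T u).Connected :=
  (connected_iff_exists_forall_reachable _).2 ⟨⟨u, by simpa using hd.symm⟩, fun y =>
    (exists_walk_induce_length_eq_dist hT.connected
      (fun _ hx _ hy _ => dist_ne_diam_of_between hT hTd hx hy) _ y).choose.reachable⟩

theorem diam_removeFar_add_one (hT : T.IsTree) (hTd : T.ediam ≠ ⊤) (hd : T.diam ≠ 0)
    (hu : T.dist u u' = T.diam) : (removeFar T u).diam + 1 = T.diam := by
  have hle : ∀ x y, T.dist x y ≤ T.diam := fun _ _ => dist_le_diam hTd
  obtain ⟨w, huw, -⟩ := exists_dist_eq_of_le hT.connected (x := u) (y := u') (s := T.diam - 1)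
    (by omega)
  suffices (removeFar T u).diam = T.diam - 1 by omega
  refine diam_eq_of_forall_dist_le (removeFar_connected hT hTd hd)
    (x := ⟨u, by simpa using hd.symm⟩) (y := ⟨w, by simp only [Set.mem_ofPred_eq]; omega⟩)
    (by rw [dist_removeFar hT hTd, huw]) ?_
  rintro ⟨x, hx⟩ ⟨y, hy⟩
  rw [dist_removeFar hT hTd]
  simp only [Set.mem_ofPred_eq] at hx hy ⊢
  have := dist_add_dist_le_or hT u u' x y
  have := hle u x
  have := hle u y
  have := hle u' x
  have := hle u' y
  omega

end RemoveFar

section Obstruction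

variable {V : Type*} {T : SimpleGraph V} {u u' p : V}

theorem not_hasUnobstructedPair_of_diam_eq_one (hd : T.diam = 1) : ¬ HasUnobstructedPair T := by
  rintro ⟨u, u', -, h⟩
  exact h u ⟨by rw [dist_self, hd], by omega⟩

theorem far_of_dist_add_one_eq_diam (hT : T.IsTree) (hTd : T.ediam ≠ ⊤)
    (hu : T.dist u u' = T.diam) {x y : V} (hx : T.dist u x ≠ T.diam) (hy : T.dist u y ≠ T.diam)
    (hxy : T.dist x y + 1 = T.diam) : (T.dist u x + 1 = T.diam ∧ T.dist u' y = T.diam) ∨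
      (T.dist u y + 1 = T.diam ∧ T.dist u' x = T.diam) := by
  have hle : ∀ x y, T.dist x y ≤ T.diam := fun _ _ => dist_le_diam hTd
  have := dist_add_dist_le_or hT u u' x y
  have := hle u x
  have := hle u y
  have := hle u' x
  have := hle u' y
  omega

theorem isPeripheral_removeFar_iff (hT : T.IsTree) (hTd : T.ediam ≠ ⊤) (hodd : Odd T.diam)
    (hd : T.diam ≠ 1) (hu : T.dist u u' = T.diam) :
    IsPeripheral (removeFar T u) 3 ↔ ∃ p, IsObstruction T u u' p := by
  have hle : ∀ x y, T.dist x y ≤ T.diam := fun _ _ => dist_le_diam hTd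
  have even_dist := (HasMedians.of_isTree hT).even_dist_add
  have hdiam := diam_removeFar_add_one hT hTd hodd.pos.ne' hu
  rw [isPeripheral_three_iff (by omega)]
  constructor
  · rintro ⟨⟨x, hx⟩, ⟨y, hy⟩, ⟨z, hz⟩, hxy, hxz, hyz⟩
    rw [dist_removeFar hT hTd] at hxy hxz hyz
    simp only [Set.mem_ofPred_eq] at hx hy hz hxy hxz hyz
    have hxy := far_of_dist_add_one_eq_diam hT hTd hu hx hy (by omega)
    have hxz := far_of_dist_add_one_eq_diam hT hTd hu hx hz (by omega)
    have hyz := far_of_dist_add_one_eq_diam hT hTd hu hy hz (by omega)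
    have isObstruction : ∀ p, T.dist u p + 1 = T.diam → T.dist u' p = T.diam →
        IsObstruction T u u' p := fun p hp hp' => ⟨hp, by omega⟩
    grind
  · rintro ⟨p, hup, hu'p⟩
    obtain ⟨w, huw, hwu'⟩ := exists_dist_eq_of_le hT.connected (x := u) (y := u')
      (s := T.diam - 1) (by omega)
    have hpw : T.dist p w + 1 = T.diam := by
      have := even_dist u u' p
      have := even_dist u p w
      have := hle u' p
      have := hle p w
      have := hT.connected.dist_triangle (u := p) (v := w) (w := u')
      have := T.dist_comm (u := p) (v := u')
      grind
    refine ⟨⟨u, ?_⟩, ⟨p, ?_⟩, ⟨w, ?_⟩, ?_, ?_, ?_⟩ <;>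
      simp only [dist_removeFar hT hTd, Set.mem_ofPred_eq, dist_self] <;> omega

theorem dist_add_one_eq_diam (hT : T.IsTree) (hTd : T.ediam ≠ ⊤) (hd : T.diam ≠ 0)
    (hper : ¬ IsPeripheral T 3) {s t : V} (hst : T.dist s t = T.diam)
    (hs : T.dist s p + 1 = T.diam) (ht : T.dist t p + 1 = T.diam)
    (hu : T.dist u u' = T.diam) : T.dist u p + 1 = T.diam := by
  rw [isPeripheral_three_iff hd] at hper
  have hle : ∀ x y, T.dist x y ≤ T.diam := fun _ _ => dist_le_diam hTd
  have hus := hle u s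
  have hut := hle u t
  have hone : ¬ (T.dist u s = T.diam ∧ T.dist u t = T.diam) := fun h =>
    hper ⟨u, s, t, h.1, h.2, hst⟩
  have := dist_add_dist_le_or hT u u' s t
  have := dist_add_dist_le_or hT u p s t
  have := dist_add_dist_le_or hT u s t p
  have := dist_add_dist_le_or hT u t s p
  have := hle u' s
  have := hle u' t
  have := T.dist_comm (u := p) (v := s)
  have := T.dist_comm (u := p) (v := t)
  have := T.dist_comm (u := s) (v := t)
  omega

theorem isPeripheral_addLeaf_iff_exists (hT : T.IsTree) (hTd : T.ediam ≠ ⊤) (hd : T.diam ≠ 0)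
    (hper : ¬ IsPeripheral T 3) : IsPeripheral (addLeaf T p) 3 ↔
      ∃ s t, T.dist s t = T.diam ∧ T.dist s p + 1 = T.diam ∧ T.dist t p + 1 = T.diam := by
  have hle : ∀ x y, T.dist x y ≤ T.diam := fun _ _ => dist_le_diam hTd
  have hdiam := diam_le_diam_addLeaf (u := p) hT.connected hTd
  have dist_some := dist_addLeaf (u := p) hT.connected
  have dist_none : ∀ a, (addLeaf T p).dist none (some a) = T.dist a p + 1 := fun a => by
    rw [SimpleGraph.dist_comm, dist_some, Option.elim]
  have hper' := mt (isPeripheral_three_iff hd).2 hper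
  constructor
  · intro h
    obtain ⟨x, y, z, hxy, hxz, hyz⟩ := (isPeripheral_three_iff (by omega)).1 h
    rcases x with _ | x <;> rcases y with _ | y <;> rcases z with _ | z <;>
      simp only [dist_some, dist_none, Option.elim, dist_self] at hxy hxz hyz
    all_goals first | omega | skip
    · have := hle y z
      exact ⟨y, z, by omega⟩
    · have := hle x z
      exact ⟨x, z, by omega⟩
    · have := hle x y
      exact ⟨x, y, by omega⟩
    · have := hle x y
      exact (hper' ⟨x, y, z, by omega⟩).elim
  · rintro ⟨s, t, hst, hs, ht⟩
    have dist_p_lt : ∀ x, T.dist x p + 1 ≤ T.diam := fun x => by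
      have := dist_add_dist_le_or hT x p s t
      have := hle x s
      have := hle x t
      have := T.dist_comm (u := p) (v := s)
      have := T.dist_comm (u := p) (v := t)
      omega
    have hdiam : (addLeaf T p).diam = T.diam :=
      diam_eq_of_forall_dist_le (addLeaf_connected hT.connected p) (x := some s) (y := some t)
        ((dist_some _ _).trans hst) (dist_addLeaf_le hT.connected hle dist_p_lt)
    refine (isPeripheral_three_iff (by omega)).2 ⟨some s, some t, none, ?_⟩
    simp only [dist_some, Option.elim, hdiam]
    exact ⟨hst, hs, ht⟩

theorem isPeripheral_addLeaf_iff (hT : T.IsTree) (hTd : T.ediam ≠ ⊤) (hd : T.diam ≠ 0)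
    (heven : Even T.diam) (hper : ¬ IsPeripheral T 3) (hu : T.dist u u' = T.diam) :
    IsPeripheral (addLeaf T p) 3 ↔ IsObstruction T u u' p := by
  rw [isPeripheral_addLeaf_iff_exists hT hTd hd hper]
  constructor
  · rintro ⟨s, t, hst, hs, ht⟩
    exact ⟨dist_add_one_eq_diam hT hTd hd hper hst hs ht hu,
      (dist_add_one_eq_diam hT hTd hd hper hst hs ht (T.dist_comm.trans hu)).ge⟩
  · rintro ⟨hup, hu'p⟩
    refine ⟨u, u', hu, hup, ?_⟩
    have hle : T.dist u' p ≤ T.diam := dist_le_diam hTd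
    have := (HasMedians.of_isTree hT).even_dist_add u u' p
    grind

theorem IsWeaklyNonThreePeripheral.not_hasUnobstructedPair [Nontrivial V] (hT : T.IsTree)
    (hTd : T.ediam ≠ ⊤) (h : IsWeaklyNonThreePeripheral T) : ¬ HasUnobstructedPair T := by
  obtain ⟨hper, hodd, heven⟩ := h
  by_cases hd : T.diam = 1
  · exact not_hasUnobstructedPair_of_diam_eq_one hd
  rintro ⟨u, u', hu, hfree⟩
  rcases T.diam.even_or_odd with hD | hD
  · obtain ⟨p, hp⟩ := heven hD
    exact hfree p ((isPeripheral_addLeaf_iff hT hTd (diam_ne_zero_of_ediam_ne_top hTd) hD hper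
      hu).1 hp)
  · obtain ⟨p, hp⟩ := (isPeripheral_removeFar_iff hT hTd hD hd hu).1
      (hodd hD u ((isPeripheralVertex_iff hT.connected hTd).2 ⟨u', hu⟩))
    exact hfree p hp

theorem IsStronglyNonThreePeripheral.hasUnobstructedPair [Nontrivial V] (hT : T.IsTree)
    (hTd : T.ediam ≠ ⊤) (hd : T.diam ≠ 1) (h : IsStronglyNonThreePeripheral T) :
    HasUnobstructedPair T := by
  obtain ⟨hper, hodd, heven⟩ := h
  rcases T.diam.even_or_odd with hD | hD
  · obtain ⟨u, u', hu⟩ := T.exists_dist_eq_diam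
    exact ⟨u, u', hu, fun p hp => heven hD p
      ((isPeripheral_addLeaf_iff hT hTd (diam_ne_zero_of_ediam_ne_top hTd) hD hper hu).2 hp)⟩
  · obtain ⟨u, hu, hfree⟩ := hodd hD
    obtain ⟨u', hu⟩ := (isPeripheralVertex_iff hT.connected hTd).1 hu
    exact ⟨u, u', hu, fun p hp => hfree ((isPeripheral_removeFar_iff hT hTd hD hd hu).2 ⟨p, hp⟩)⟩

end Obstruction

end AntiVdW

theorem theorem1p3_general {V W : Type*} [Nontrivial V] [Nontrivial W]
    (T : SimpleGraph V) (T' : SimpleGraph W) (hT : T.IsTree) (hT' : T'.IsTree)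
    (hTd : T.ediam ≠ ⊤) (hTd' : T'.ediam ≠ ⊤) (hdiam : Even (T □ T').diam) :
    ((AntiVdW.IsWeaklyNonThreePeripheral T ∨ AntiVdW.IsWeaklyNonThreePeripheral T' ∨
        AntiVdW.IsP2 T ∨ AntiVdW.IsP2 T') →
      AntiVdW.aw (T □ T') 3 = 3) ∧
    ((AntiVdW.IsStronglyNonThreePeripheral T ∧ AntiVdW.IsStronglyNonThreePeripheral T' ∧
        ¬ AntiVdW.IsP2 T ∧ ¬ AntiVdW.IsP2 T') →
      AntiVdW.aw (T □ T') 3 = 4) := by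
  rw [AntiVdW.diam_boxProd hT.connected hT'.connected hTd hTd'] at hdiam
  rw [AntiVdW.isP2_iff_diam_eq_one hT, AntiVdW.isP2_iff_diam_eq_one hT']
  constructor
  · intro h
    refine AntiVdW.aw_boxProd_eq_three hT hTd hT' hTd' hdiam fun ⟨hu, hu'⟩ => ?_
    rcases h with h | h | h | h
    · exact h.not_hasUnobstructedPair hT hTd hu
    · exact h.not_hasUnobstructedPair hT' hTd' hu'
    · exact AntiVdW.not_hasUnobstructedPair_of_diam_eq_one h hu
    · exact AntiVdW.not_hasUnobstructedPair_of_diam_eq_one h hu'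
  · rintro ⟨h, h', hd, hd'⟩
    exact AntiVdW.aw_boxProd_eq_four hT hTd hT' hTd' hdiam (h.hasUnobstructedPair hT hTd hd)
      (h'.hasUnobstructedPair hT' hTd' hd')

theorem theorem1p3 {V W : Type*} [Finite V] [Finite W] [Nontrivial V] [Nontrivial W]
    (T : SimpleGraph V) (T' : SimpleGraph W) (hT : T.IsTree) (hT' : T'.IsTree)
    (hdiam : Even (T □ T').diam) :
    ((AntiVdW.IsWeaklyNonThreePeripheral T ∨ AntiVdW.IsWeaklyNonThreePeripheral T' ∨
        AntiVdW.IsP2 T ∨ AntiVdW.IsP2 T') →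
      AntiVdW.aw (T □ T') 3 = 3) ∧
    ((AntiVdW.IsStronglyNonThreePeripheral T ∧ AntiVdW.IsStronglyNonThreePeripheral T' ∧
        ¬ AntiVdW.IsP2 T ∧ ¬ AntiVdW.IsP2 T') →
      AntiVdW.aw (T □ T') 3 = 4) :=
  theorem1p3_general T T' hT hT' (SimpleGraph.connected_iff_ediam_ne_top.1 hT.connected)
    (SimpleGraph.connected_iff_ediam_ne_top.1 hT'.connected) hdiam
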